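/- **Conventions.** Let $M$ be a compact manifold of dimension $n\ge 1$ (topological, with a fixed compatible metric $d$) with non-empty boundary $\partial M$. A subset $E\subset M$ is a *boundary retract* of $M$ if there is a continuous map $\Psi\colon\partial M\times[0,1]\to M$ such that $\Psi|_{\partial M\times[0,1)}$ is a homeomorphism onto $M\setminus E$, $\Psi(\eta,0)=\eta$ for all $\eta\in\partial M$, and $\Psi(\partial M\times\{1\})=E$; the associated retraction $R\colon M\to E$ is $R(\Psi(\eta,s))=\Psi(\eta,1)$. An *unwrapping* of a continuous map $f\colon E\to E$ is a homeomorphism $\bar f\colon M\to M$ such that $R\circ\bar f|_E=f$ and, for some $k>0$, $\bar f^{\,k}$ is the identity on $\partial M$. A continuous family $\{f_t\}$ of self-maps of $E$ *unwraps in $M$* if there is a continuous family $\{\bar f_t\}$ such that $\bar f_t$ is an unwrapping of $f_t$ for each $t$. The map $f$ *stabilizes at iterate $m$* if $f^{m+1}(E)=f^m(E)$. The inverse limit is $\varprojlim(E,f)=\{(x_0,x_1,\dots)\in E^{\mathbb N}: f(x_{i+1})=x_i \text{ for all } i\}$ with the product topology, and the natural extension of $f$ is its self-homeomorphism $\hat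 f(x_0,x_1,\dots)=(f(x_0),x_0,x_1,\dots)$. Continuity of families, and distances between maps, refer to the uniform metric. **Theorem.** Let $E$ be a boundary retract of $M$, let $I$ be a compact metric space, and let $\{f_t\}_{t\in I}$ be a continuous family of continuous self-maps of $E$ which unwraps in $M$, with a continuous family of unwrappings $\{\bar f_t\}_{t\in I}$. Suppose that there is an integer $m\ge 0$ such that every $f_t$ stabilizes at iterate $m$. Then for each $\varepsilon>0$ there is a continuous family $\{\Phi_t\}_{t\in I}$ of homeomorphisms of $M$, together with non-empty compact sets $\Lambda_t\subset M$ satisfying $\Phi_t(\Lambda_t)=\Lambda_t$, such that: (a) for each $t\in I$, (i) $\Phi_t|_{\Lambda_t}$ is topologically conjugate to $\hat f_t\colon\varprojlim(E,f_t)\to\varprojlim(E,f_t)$; (ii) if $x\in M\setminus\partial M$, then the $\omega$-limit set $\omega(x,\Phi_t)$ is contained in $\Lambda_t$; (iii) there is $k>0$ such that $\Phi_t^k$ is the identity on $\partial M$; moreover, $\Phi_t^k$ is the identity on $\partial M$ for every $k$ for which $\bar f_t^{\,k}$ is (so a single $k$ serves for all $t$ if it does so for the unwrappings). (b) There is a continuous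 family $\{g_t\}_{t\in I}$ of continuous maps $M\to M$ with $d(g_t,\mathrm{id})<\varepsilon$, $g_t(\Lambda_t)=f_t^m(E)$, and $f_t\circ g_t|_{\Lambda_t}=g_t\circ\Phi_t|_{\Lambda_t}$ for each $t$. (c) For each $t$, $g_t$ restricts to a bijection from the set of periodic points of $\Phi_t$ in $\Lambda_t$ to the set of periodic points of $f_t$. (d) The sets $\Lambda_t$ vary continuously with $t\in I$ in the Hausdorff metric. -/

import Mathlib

open Topology Set Filter

/-- The boundary of an `n`-dimensional topological manifold `M`: the points with no open
neighbourhood homeomorphic to an open subset of `ℝⁿ` (the complement of the manifold interior). -/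
def manifoldBoundary (n : ℕ) (M : Type*) [TopologicalSpace M] : Set M :=
  {x | ¬ ∃ e : OpenPartialHomeomorph M (EuclideanSpace ℝ (Fin n)), x ∈ e.source}

/-- The data `Ψ : ∂M × [0,1] → M` which exhibit `E` as a boundary retract of `M`. -/
structure BoundaryRetract (n : ℕ) {M : Type*} [TopologicalSpace M] (E : Set M) where
  /-- the map `Ψ` -/
  Ψ : C(manifoldBoundary n M × unitInterval, M)
  /-- `Ψ` restricted to `∂M × [0,1)` is a homeomorphism onto its image … -/
  isEmbedding : IsEmbedding (({p | p.2 < 1} : Set (manifoldBoundary n M × unitInterval)).domRestrict Ψ)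
  /-- … which is `M - E`. -/
  image_lt_one : Ψ '' {p | p.2 < 1} = Eᶜ
  apply_zero : ∀ η : manifoldBoundary n M, Ψ (η, 0) = η
  image_one : Ψ '' {p | p.2 = 1} = E

namespace BoundaryRetract

variable {n : ℕ} {M : Type*} [TopologicalSpace M] {E : Set M}

theorem surjective (B : BoundaryRetract n E) : Function.Surjective B.Ψ := by
  intro x
  by_cases hx : x ∈ E
  · rw [← B.image_one] at hx
    obtain ⟨p, -, hp⟩ := hx
    exact ⟨p, hp⟩
  · have hx' : x ∈ Eᶜ := hx
    rw [← B.image_lt_one] at hx'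
    obtain ⟨p, -, hp⟩ := hx'
    exact ⟨p, hp⟩

/-- The retraction `R : M → E` associated with `Ψ`, given by `R (Ψ (η, s)) = Ψ (η, 1)`
(see `retraction_apply` for the fact that this is well defined). -/
noncomputable def retraction (B : BoundaryRetract n E) (x : M) : E :=
  ⟨B.Ψ ((B.surjective x).choose.1, 1), by
    have h : B.Ψ ((B.surjective x).choose.1, 1) ∈ B.Ψ '' {p | p.2 = 1} := ⟨_, rfl, rfl⟩
    rwa [B.image_one] at h⟩

theorem retraction_apply (B : BoundaryRetract n E) (η : manifoldBoundary n M)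
    (s : unitInterval) : (B.retraction (B.Ψ (η, s)) : M) = B.Ψ (η, 1) := by
  have key : ∀ p q : manifoldBoundary n M × unitInterval, B.Ψ p = B.Ψ q → p.2 < 1 → p = q := by
    intro p q h hp
    have hq : q.2 < 1 := by
      refine lt_of_le_of_ne unitInterval.le_one' fun hq => ?_
      have h1 : B.Ψ p ∈ Eᶜ := B.image_lt_one ▸ ⟨p, hp, rfl⟩
      have h2 : B.Ψ q ∈ E := by
        have h3 : B.Ψ q ∈ B.Ψ '' {p | p.2 = 1} := ⟨q, hq, rfl⟩
        rwa [B.image_one] at h3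
      exact h1 (h ▸ h2)
    have := @B.isEmbedding.injective ⟨p, hp⟩ ⟨q, hq⟩ h
    exact congrArg Subtype.val this
  have hc := (B.surjective (B.Ψ (η, s))).choose_spec
  change B.Ψ ((B.surjective (B.Ψ (η, s))).choose.1, 1) = B.Ψ (η, 1)
  generalize (B.surjective (B.Ψ (η, s))).choose = q at hc
  rcases lt_or_eq_of_le (unitInterval.le_one' (t := s)) with hs | hs
  · rw [← key (η, s) q hc.symm hs]
  · rcases lt_or_eq_of_le (unitInterval.le_one' (t := q.2)) with hq | hq
    · rw [key q (η, s) hc hq]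
    · obtain ⟨a, b⟩ := q
      obtain rfl : b = 1 := hq
      subst hs
      exact hc

/-- The homeomorphism `F : M → M` is an unwrapping of `f : E → E`. -/
def IsUnwrapping (B : BoundaryRetract n E) (f : C(E, E)) (F : M ≃ₜ M) : Prop :=
  (∀ x : E, B.retraction (F x) = f x) ∧
    ∃ k : ℕ, 0 < k ∧ ∀ x ∈ manifoldBoundary n M, F^[k] x = x

end BoundaryRetract

/-- `f` stabilizes at iterate `m`: `f^{m+1}(X) = f^m(X)`. -/
def StabilizesAt {X : Type*} (f : X → X) (m : ℕ) : Prop :=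
  range f^[m + 1] = range f^[m]

/-- The inverse limit of `f : X → X`, with the topology induced from the product `X^ℕ`. -/
abbrev InverseLimit {X : Type*} (f : X → X) : Type _ :=
  {x : ℕ → X // ∀ i, f (x (i + 1)) = x i}

/-- The natural extension `(x₀, x₁, …) ↦ (f x₀, x₀, x₁, …)` of `f`, a homeomorphism of the
inverse limit; its inverse is the shift. -/
def naturalExtension {X : Type*} [TopologicalSpace X] (f : C(X, X)) :
    InverseLimit f ≃ₜ InverseLimit f where
  toFun x := ⟨fun i => Nat.casesOn i (f (x.1 0)) x.1, by
    rintro (_ | i)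
    · rfl
    · exact x.2 i⟩
  invFun x := ⟨fun i => x.1 (i + 1), fun i => x.2 (i + 1)⟩
  left_inv x := rfl
  right_inv x := by
    apply Subtype.ext
    funext i
    cases i with
    | zero => exact x.2 0
    | succ i => rfl
  continuous_toFun := by
    refine Continuous.subtype_mk (continuous_pi fun i => ?_) _
    cases i with
    | zero => exact f.continuous.comp ((continuous_apply 0).comp continuous_subtype_val)
    | succ i => exact (continuous_apply i).comp continuous_subtype_val
  continuous_invFun := by
    refine Continuous.subtype_mk (continuous_pi fun i => ?_) _
    exact (continuous_apply (i + 1)).comp continuous_subtype_val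

/-!
The family is regarded as one homeomorphism `G (t, x) = (t, F t x)` of the compact metric space
`I × M`, which preserves the fibers of the projection to `I`. Continuity in the parameter is then
continuity on `I × M`.

The rays `s ↦ Ψ (η, s)` are used to turn `G` into a map `H` (`RadialStructure.collapse`) which
extends the maps `f t` from `E` to `M`. The homeomorphism `G` is first conjugated into the image of
the embedding `shrink`, which pulls `M` away from its boundary and fixes `E`, and is extended over
the remaining collar `Ψ (∂M × [0, 1/2])` as a product with the identity; then `smash` doubles the
radial coordinate `s` and so collapses the image of `shrink` onto `E` along the rays. The result
agrees with `R ∘ F t = f t` on `E` and with `F t` on `∂M`, and under its iterates every point off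
`∂M` reaches `E` after finitely many steps. Since `min (2 s) 1` is a uniform limit of homeomorphisms
of `[0, 1]`, the map `H` is a uniform limit of fibered homeomorphisms which agree with `G` on `∂M`
(`RadialStructure.exists_homeomorph_dist_collapse_lt`).

By a theorem of Brown (`exists_homeomorph_inverseLimit`), the inverse limit of `H` is therefore
homeomorphic to `I × M`, by a homeomorphism `β` which is as close as desired to the projection to
the coordinate `0`, is fibered over `I`, and equals this projection over `∂M`. Conjugating the
natural extension of `H` by `β` gives the homeomorphisms `Φ t`; the sets `Λ t` are the images under
`β` of the inverse limits of `f t`, and `g t` is the coordinate `0` of `β⁻¹`. The natural extension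
acts coordinatewise by `H`, and each coordinate of a point off `∂M` ends up in `E`; this gives the
statement on `ω`-limit sets. Stabilization says that every point of the image of `(f t)^[m]`, which
varies continuously with `t`, is any prescribed coordinate of some point of the inverse limit; this
gives the image of `g t` and the lower semicontinuity of `Λ`, while upper semicontinuity is
compactness.
-/

/-! ### Inverse limits and natural extensions -/

section InverseLimit

variable {X : Type*} {f : X → X}

theorem InverseLimit.iterate_apply (x : InverseLimit f) (i k : ℕ) :
    f^[k] (x.1 (i + k)) = x.1 i := by
  induction k with
  | zero => rfl
  | succ k ih => rw [Function.iterate_succ_apply, ← add_assoc, x.2, ih]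

instance InverseLimit.instCompactSpace [TopologicalSpace X] [T2Space X] [CompactSpace X]
    (f : C(X, X)) : CompactSpace (InverseLimit f) := by
  have h : {x : ℕ → X | ∀ i, f (x (i + 1)) = x i} =
      ⋂ i, {x : ℕ → X | f (x (i + 1)) = x i} := by
    ext; simp
  have hclosed : IsClosed {x : ℕ → X | ∀ i, f (x (i + 1)) = x i} := by
    rw [h]
    exact isClosed_iInter fun i => isClosed_eq (by fun_prop) (by fun_prop)
  exact isCompact_iff_compactSpace.1 hclosed.isCompact

/-- The natural extension acts coordinatewise, because `f (x (i + 1)) = x i`. -/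
theorem naturalExtension_apply [TopologicalSpace X] (f : C(X, X)) (x : InverseLimit f) (i : ℕ) :
    (naturalExtension f x).1 i = f (x.1 i) := by
  cases i with
  | zero => rfl
  | succ i => exact (x.2 i).symm

theorem naturalExtension_iterate_apply [TopologicalSpace X] (f : C(X, X)) (x : InverseLimit f)
    (k i : ℕ) : ((naturalExtension f)^[k] x).1 i = f^[k] (x.1 i) := by
  induction k with
  | zero => rfl
  | succ k ih =>
    rw [Function.iterate_succ_apply', naturalExtension_apply, ih, Function.iterate_succ_apply']

end InverseLimit

/-! ### Inverse limits of uniform limits of homeomorphisms -/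

section NearHomeomorphism

variable {X : Type*} [MetricSpace X] [CompactSpace X]

/-- Both estimates follow from the closeness of `h` to `H` and the uniform continuity of `c` and of
finitely many iterates of `H`; the second concerns `H^[k] ∘ h` and `H^[k] ∘ H`. -/
theorem exists_homeomorph_step (H : C(X, X)) {P : (X ≃ₜ X) → Prop}
    (happrox : ∀ δ > 0, ∃ h : X ≃ₜ X, P h ∧ ∀ x, dist (h x) (H x) < δ)
    (c : X ≃ₜ X) (n : ℕ) {η : ℝ} (hη : 0 < η) :
    ∃ h : X ≃ₜ X, P h ∧ (∀ x, dist (c (H x)) (c (h x)) ≤ η) ∧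
      ∀ k ≤ n, ∀ x, dist (H^[k] (h x)) (H^[k + 1] x) ≤ η := by
  let Q : X → X × (Fin (n + 1) → X) := fun x => (c x, fun k => H^[k] x)
  have hQ : Continuous Q :=
    c.continuous.prodMk (continuous_pi fun k => H.continuous.iterate k)
  obtain ⟨δ, hδ, hQδ⟩ := Metric.uniformContinuous_iff.1
    (CompactSpace.uniformContinuous_of_continuous hQ) η hη
  obtain ⟨h, hP, hh⟩ := happrox δ hδ
  refine ⟨h, hP, fun x => ?_, fun k hk x => ?_⟩
  · rw [dist_comm]
    exact (le_max_left _ _).trans (hQδ (hh x)).le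
  · have := (dist_le_pi_dist (Q (h x)).2 (Q (H x)).2 ⟨k, by omega⟩).trans
      ((le_max_right _ _).trans (hQδ (hh x)).le)
    exact this

/-- A sequence of compositions `c i` of homeomorphisms near `H`, chosen so closely that both
`c i ∘ H` and `c (i + 1)`, and `H^[k] ∘ (c i)⁻¹` and `H^[k + 1] ∘ (c (i + 1))⁻¹` for `k ≤ i`, differ
by the terms of a geometric series. -/
theorem exists_homeomorph_seq (H : C(X, X)) {P : (X ≃ₜ X) → Prop}
    (happrox : ∀ δ > 0, ∃ h : X ≃ₜ X, P h ∧ ∀ x, dist (h x) (H x) < δ) {η : ℝ} (hη : 0 < η) :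
    ∃ c : ℕ → X ≃ₜ X, c 0 = Homeomorph.refl X ∧
      (∀ i, ∃ h : X ≃ₜ X, P h ∧ c (i + 1) = h.trans (c i)) ∧
      (∀ i x, dist (c i (H x)) (c (i + 1) x) ≤ η / 2 / 2 ^ i) ∧
      ∀ i, ∀ k ≤ i, ∀ z,
        dist (H^[k] ((c i).symm z)) (H^[k + 1] ((c (i + 1)).symm z)) ≤ η / 2 / 2 ^ i := by
  have hpos (i : ℕ) : 0 < η / 2 / 2 ^ i := by positivity
  choose h hP h1 h2 using fun (i : ℕ) (c : X ≃ₜ X) => exists_homeomorph_step H happrox c i (hpos i)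
  let c : ℕ → X ≃ₜ X := fun i => Nat.rec (Homeomorph.refl X) (fun i c => (h i c).trans c) i
  refine ⟨c, rfl, fun i => ⟨h i (c i), hP _ _, rfl⟩, fun i x => h1 i (c i) x, fun i k hk z => ?_⟩
  have := h2 i (c i) k hk ((h i (c i)).symm ((c i).symm z))
  rwa [Homeomorph.apply_symm_apply] at this

/-- The uniform limit of `H^[k] ∘ (c (i + k))⁻¹` exists. It is the coordinate `i` of the inverse of
the homeomorphism of `exists_homeomorph_inverseLimit`. -/
theorem exists_tendsto_iterate_comp_symm (H : C(X, X)) {c : ℕ → X ≃ₜ X} {η : ℝ} (hη : 0 < η)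
    (hc : ∀ i, ∀ k ≤ i, ∀ z,
      dist (H^[k] ((c i).symm z)) (H^[k + 1] ((c (i + 1)).symm z)) ≤ η / 2 / 2 ^ i) (i : ℕ) :
    ∃ α : C(X, X), Tendsto (fun k => (⟨fun z => H^[k] ((c (i + k)).symm z),
      (H.continuous.iterate k).comp (c (i + k)).symm.continuous⟩ : C(X, X))) atTop (𝓝 α) := by
  refine cauchySeq_tendsto_of_complete (cauchySeq_of_le_geometric_two (C := η) fun k => ?_)
  rw [ContinuousMap.dist_le (by positivity)]
  intro z
  refine (hc (i + k) k (by omega) z).trans ?_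
  gcongr
  · norm_num
  · omega

/-- Brown's theorem for a single map: the inverse limit of a uniform limit `H` of homeomorphisms of
a compact metric space is homeomorphic to the space. The homeomorphism `β` is the uniform limit of
`x ↦ c i (x i)`, where the `c i` are compositions of homeomorphisms near `H`, so any property which
these maps share and which is closed under limits passes to `β`. -/
theorem exists_homeomorph_inverseLimit (H : C(X, X)) {P : (X ≃ₜ X) → Prop}
    (happrox : ∀ δ > 0, ∃ h : X ≃ₜ X, P h ∧ ∀ x, dist (h x) (H x) < δ) {ε : ℝ} (hε : 0 < ε) :
    ∃ (c : ℕ → X ≃ₜ X) (β : InverseLimit H ≃ₜ X), c 0 = Homeomorph.refl X ∧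
      (∀ i, ∃ h : X ≃ₜ X, P h ∧ c (i + 1) = h.trans (c i)) ∧
      (∀ x, dist (β x) (x.1 0) < ε) ∧
      ∀ x, Tendsto (fun i => c i (x.1 i)) atTop (𝓝 (β x)) := by
  have hη : 0 < ε / 2 := by positivity
  obtain ⟨c, hc0, hcP, hcA, hcB⟩ := exists_homeomorph_seq H happrox hη
  let b : ℕ → C(InverseLimit H, X) := fun i =>
    ⟨fun x => c i (x.1 i), (c i).continuous.comp ((continuous_apply i).comp continuous_subtype_val)⟩
  have hb (i : ℕ) : dist (b i) (b (i + 1)) ≤ ε / 2 / 2 / 2 ^ i := by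
    rw [ContinuousMap.dist_le (by positivity)]
    intro x
    have := hcA i (x.1 (i + 1))
    rwa [x.2 i] at this
  obtain ⟨β, hβ⟩ := cauchySeq_tendsto_of_complete (cauchySeq_of_le_geometric_two hb)
  have hβx (x : InverseLimit H) : Tendsto (fun i => c i (x.1 i)) atTop (𝓝 (β x)) :=
    ((continuous_eval_const x).tendsto β).comp hβ
  choose α hα using exists_tendsto_iterate_comp_symm H hη hcB
  have hαz (i : ℕ) (z : X) : Tendsto (fun k => H^[k] ((c (i + k)).symm z)) atTop (𝓝 (α i z)) :=
    ((continuous_eval_const z).tendsto (α i)).comp (hα i)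
  have hleft (x : InverseLimit H) (i : ℕ) : α i (β x) = x.1 i := by
    have h1 : Tendsto (fun k => c (i + k) (x.1 (i + k))) atTop (𝓝 (β x)) :=
      (hβx x).comp (tendsto_atTop_mono (fun k => Nat.le_add_left k i) tendsto_id)
    have h2 := (hα i).eval h1
    refine tendsto_nhds_unique h2 (tendsto_const_nhds.congr fun k => ?_)
    simp only [ContinuousMap.coe_mk, Homeomorph.symm_apply_apply]
    exact (x.iterate_apply i k).symm
  have hαH (i : ℕ) (z : X) : H (α (i + 1) z) = α i z := by
    refine tendsto_nhds_unique ((H.continuous.tendsto _).comp (hαz (i + 1) z)) ?_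
    refine ((hαz i z).comp (tendsto_add_atTop_nat 1)).congr fun k => ?_
    simp only [Function.comp_apply]
    rw [Function.iterate_succ_apply', show i + (k + 1) = i + 1 + k by omega]
  -- The distances between consecutive `c j (H^[l + k - j] u)`, for `l ≤ j ≤ l + k`, add up to a
  -- partial geometric sum.
  have hest (l k : ℕ) (u : X) :
      dist (c l (H^[k] u)) (c (l + k) u) ≤ ε / 2 / 2 ^ l - ε / 2 / 2 ^ (l + k) := by
    induction k generalizing u with
    | zero => simp
    | succ k ih =>
      have h1 := ih (H u)
      have h2 := hcA (l + k) u
      have h3 := dist_triangle (c l (H^[k] (H u))) (c (l + k) (H u)) (c (l + k + 1) u)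
      have h4 : ε / 2 / 2 ^ (l + k) = 2 * (ε / 2 / 2 ^ (l + k + 1)) := by
        rw [pow_succ]; field_simp
      have h5 : ε / 2 / 2 / 2 ^ (l + k) = ε / 2 / 2 ^ (l + k + 1) := by
        rw [pow_succ]; field_simp
      rw [Function.iterate_succ_apply, ← add_assoc]
      linarith
  have hright (z : X) : β ⟨fun i => α i z, fun i => hαH i z⟩ = z := by
    refine tendsto_nhds_unique (hβx _) ?_
    refine tendsto_iff_dist_tendsto_zero.2 (squeeze_zero (fun _ => dist_nonneg)
      (g := fun l => ε / 2 / 2 ^ l) (fun l => ?_) ?_)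
    · refine le_of_tendsto ((((c l).continuous.tendsto _).comp (hαz l z)).dist
        tendsto_const_nhds) (Eventually.of_forall fun k => ?_)
      have := hest l k ((c (l + k)).symm z)
      rw [Homeomorph.apply_symm_apply] at this
      refine this.trans (sub_le_self _ (by positivity))
    · exact tendsto_const_nhds.div_atTop (tendsto_pow_atTop_atTop_of_one_lt one_lt_two)
  let e : InverseLimit H ≃ X :=
    { toFun := β
      invFun := fun z => ⟨fun i => α i z, fun i => hαH i z⟩
      left_inv := fun x => Subtype.ext (funext (hleft x))
      right_inv := hright }
  refine ⟨c, Continuous.homeoOfEquivCompactToT2 (f := e) β.continuous, hc0, hcP, fun x => ?_, hβx⟩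
  have h0 : dist (x.1 0) (β x) ≤ ε / 2 := by
    have := dist_le_of_le_geometric_two_of_tendsto₀
      (f := fun i => c i (x.1 i)) (C := ε / 2) (a := β x)
      (fun i => (ContinuousMap.dist_apply_le_dist x).trans (hb i)) (hβx x)
    simpa [hc0] using this
  rw [dist_comm]
  exact h0.trans_lt (by linarith)

end NearHomeomorphism

/-! ### Self-maps of the unit interval -/

namespace unitInterval

/-- The map `s ↦ min (2 s) 1`, which collapses `[1/2, 1]` to `1`. -/
noncomputable def doubleMin : C(unitInterval, unitInterval) where
  toFun s := ⟨min (2 * s) 1, le_min (by linarith [s.2.1]) zero_le_one, min_le_right _ _⟩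
  continuous_toFun := by fun_prop

/-- The map `s ↦ (1 + s) / 2`, which shrinks `[0, 1]` onto `[1/2, 1]`. -/
noncomputable def upperHalf : C(unitInterval, unitInterval) where
  toFun s := ⟨(1 + s) / 2, by linarith [s.2.1], by linarith [s.2.2]⟩
  continuous_toFun := by fun_prop

/-- The map `s ↦ max (2 s - 1) 0`, a left inverse of `upperHalf`. -/
noncomputable def doubleSubOne : C(unitInterval, unitInterval) where
  toFun s := ⟨max (2 * s - 1) 0, le_max_right _ _, max_le (by linarith [s.2.2]) zero_le_one⟩
  continuous_toFun := by fun_prop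

/-- The convex combination of `doubleMin` and the identity with weight `c` on the identity. -/
noncomputable def doubleMinInterp (c : unitInterval) : C(unitInterval, unitInterval) where
  toFun s := ⟨(1 - c) * min (2 * (s : ℝ)) 1 + c * s, by
    have h : (0 : ℝ) ≤ min (2 * (s : ℝ)) 1 := le_min (by linarith [s.2.1]) zero_le_one
    have := mul_nonneg (sub_nonneg.2 c.2.2) h
    have := mul_nonneg c.2.1 s.2.1
    linarith, by
    have := mul_le_mul_of_nonneg_left (min_le_right (2 * (s : ℝ)) 1) (sub_nonneg.2 c.2.2)
    have := mul_le_mul_of_nonneg_left s.2.2 c.2.1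
    linarith⟩
  continuous_toFun := by fun_prop

theorem doubleMin_one : doubleMin 1 = 1 := by ext; simp [doubleMin]

theorem doubleMin_zero : doubleMin 0 = 0 := by ext; simp [doubleMin]

theorem upperHalf_one : upperHalf 1 = 1 := by ext; norm_num [upperHalf]

theorem doubleSubOne_one : doubleSubOne 1 = 1 := by ext; norm_num [doubleSubOne]

theorem doubleMinInterp_one (c : unitInterval) : doubleMinInterp c 1 = 1 := by
  ext; simp [doubleMinInterp]

theorem doubleMinInterp_zero (c : unitInterval) : doubleMinInterp c 0 = 0 := by
  ext; simp [doubleMinInterp]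

theorem doubleSubOne_upperHalf (s : unitInterval) : doubleSubOne (upperHalf s) = s := by
  ext
  change max (2 * ((1 + (s : ℝ)) / 2) - 1) 0 = s
  rw [max_eq_left] <;> linarith [s.2.1]

theorem upperHalf_doubleSubOne {s : unitInterval} (hs : 1 / 2 ≤ (s : ℝ)) :
    upperHalf (doubleSubOne s) = s := by
  ext
  change (1 + max (2 * (s : ℝ) - 1) 0) / 2 = s
  rw [max_eq_left (by linarith)]
  ring

theorem doubleMin_upperHalf (s : unitInterval) : doubleMin (upperHalf s) = 1 := by
  ext
  change min (2 * ((1 + (s : ℝ)) / 2)) 1 = 1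
  exact min_eq_right (by linarith [s.2.1])

theorem coe_doubleMin {s : unitInterval} (hs : (s : ℝ) ≤ 1 / 2) : (doubleMin s : ℝ) = 2 * s :=
  min_eq_left (by linarith)

theorem strictMono_doubleMinInterp {c : unitInterval} (hc : 0 < (c : ℝ)) :
    StrictMono (doubleMinInterp c) := by
  intro s t hst
  have hst : (s : ℝ) < t := hst
  change (1 - (c : ℝ)) * min (2 * (s : ℝ)) 1 + c * s < (1 - (c : ℝ)) * min (2 * (t : ℝ)) 1 + c * t
  have h1 : min (2 * (s : ℝ)) 1 ≤ min (2 * (t : ℝ)) 1 := min_le_min_right _ (by linarith)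
  have := mul_le_mul_of_nonneg_left h1 (sub_nonneg.2 c.2.2)
  have := mul_lt_mul_of_pos_left hst hc
  linarith

/-- `doubleMinInterp c` as a homeomorphism of `[0, 1]`, for positive `c`. -/
noncomputable def doubleMinHomeomorph {c : unitInterval} (hc : 0 < (c : ℝ)) :
    unitInterval ≃ₜ unitInterval :=
  Continuous.homeoOfEquivCompactToT2
    (f := Equiv.ofBijective (doubleMinInterp c) ⟨(strictMono_doubleMinInterp hc).injective,
      fun t => mem_range_of_exists_le_of_exists_ge (doubleMinInterp c).continuous
        ⟨0, (doubleMinInterp_zero c).trans_le t.2.1⟩ ⟨1, (doubleMinInterp_one c).symm ▸ t.2.2⟩⟩)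
    (doubleMinInterp c).continuous

theorem dist_doubleMinInterp_le (c s : unitInterval) :
    dist (doubleMinInterp c s) (doubleMin s) ≤ c := by
  change |(1 - (c : ℝ)) * min (2 * (s : ℝ)) 1 + c * s - min (2 * (s : ℝ)) 1| ≤ c
  have h0 : (0 : ℝ) ≤ min (2 * (s : ℝ)) 1 := le_min (by linarith [s.2.1]) zero_le_one
  have h1 : min (2 * (s : ℝ)) 1 ≤ 1 := min_le_right _ _
  rw [show (1 - (c : ℝ)) * min (2 * (s : ℝ)) 1 + c * s - min (2 * (s : ℝ)) 1
    = c * (s - min (2 * (s : ℝ)) 1) by ring, abs_mul, abs_of_nonneg c.2.1]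
  refine mul_le_of_le_one_right c.2.1 (abs_le.2 ⟨?_, ?_⟩) <;> linarith [s.2.1, s.2.2]

end unitInterval

/-! ### Radial maps and the collapse onto the core -/

/-- A presentation of `X` as a quotient of `D × [0, 1]`, where `D ⊆ X` is embedded as `D × {0}` and
all identifications take place in `D × {1}`. -/
structure RadialStructure {X : Type*} [TopologicalSpace X] (D : Set X) where
  /-- the quotient map -/
  ψ : C(D × unitInterval, X)
  apply_zero : ∀ d : D, ψ (d, 0) = d
  surjective : Function.Surjective ψ
  eq_or_eq_one : ∀ p q, ψ p = ψ q → p = q ∨ p.2 = 1 ∧ q.2 = 1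

namespace RadialStructure

open unitInterval

variable {X : Type*} [TopologicalSpace X] {D : Set X} (A : RadialStructure D)

/-- The image of `D × {1}`. -/
def core : Set X := A.ψ '' {p | p.2 = 1}

theorem apply_one_mem_core (d : D) : A.ψ (d, 1) ∈ A.core := ⟨(d, 1), rfl, rfl⟩

theorem apply_mem_iff (d : D) (s : unitInterval) : A.ψ (d, s) ∈ D ↔ s = 0 := by
  refine ⟨fun h => ?_, fun h => by rw [h, A.apply_zero]; exact d.2⟩
  rcases A.eq_or_eq_one (d, s) (⟨_, h⟩, 0) (A.apply_zero ⟨_, h⟩).symm with h | h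
  · exact congrArg Prod.snd h
  · exact absurd h.2 zero_ne_one

variable [T2Space X] [CompactSpace D]

theorem isQuotientMap : IsQuotientMap A.ψ :=
  A.ψ.continuous.isClosedMap.isQuotientMap A.ψ.continuous A.surjective

theorem lift_apply (g : C(D × unitInterval, X)) (hg : Function.FactorsThrough g A.ψ)
    (p : D × unitInterval) : A.isQuotientMap.lift g hg (A.ψ p) = g p :=
  DFunLike.congr_fun (A.isQuotientMap.lift_comp g hg) p

/-- The self-map `ψ (d, s) ↦ ψ (d, l s)` of `X`, where `l` fixes `1`. -/
noncomputable def radial (l : C(unitInterval, unitInterval)) (hl : l 1 = 1) : C(X, X) :=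
  A.isQuotientMap.lift (A.ψ.comp ((ContinuousMap.id D).prodMap l)) (by
    rintro ⟨d, s⟩ ⟨d', s'⟩ h
    rcases A.eq_or_eq_one _ _ h with h' | ⟨hs, hs'⟩
    · rw [h']
    · obtain rfl : s = 1 := hs
      obtain rfl : s' = 1 := hs'
      simpa [hl] using h)

@[simp]
theorem radial_apply (l : C(unitInterval, unitInterval)) (hl : l 1 = 1) (d : D)
    (s : unitInterval) : A.radial l hl (A.ψ (d, s)) = A.ψ (d, l s) :=
  A.lift_apply _ _ (d, s)

/-- The homeomorphism of `X` induced by a homeomorphism of `[0, 1]` which fixes `1`. -/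
noncomputable def radialHomeomorph (l : unitInterval ≃ₜ unitInterval) (hl : l 1 = 1) : X ≃ₜ X where
  toFun := A.radial l hl
  invFun := A.radial l.symm (l.symm_apply_eq.2 hl.symm)
  left_inv x := by
    obtain ⟨⟨d, s⟩, rfl⟩ := A.surjective x
    simp
  right_inv x := by
    obtain ⟨⟨d, s⟩, rfl⟩ := A.surjective x
    simp
  continuous_toFun := (A.radial _ _).continuous
  continuous_invFun := (A.radial _ _).continuous

/-- The retraction `ψ (d, s) ↦ ψ (d, 1)` onto the core. -/
noncomputable def retract : C(X, X) := A.radial (.const _ 1) rfl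

/-- The embedding `ψ (d, s) ↦ ψ (d, (1 + s) / 2)`, which shrinks `X` away from `D`. -/
noncomputable def shrink : C(X, X) := A.radial upperHalf upperHalf_one

/-- The map `ψ (d, s) ↦ ψ (d, min (2 s) 1)`, which smashes the image of `shrink` onto the core. -/
noncomputable def smash : C(X, X) := A.radial doubleMin doubleMin_one

@[simp]
theorem retract_apply (d : D) (s : unitInterval) : A.retract (A.ψ (d, s)) = A.ψ (d, 1) :=
  A.radial_apply _ _ d s

@[simp]
theorem shrink_apply (d : D) (s : unitInterval) :
    A.shrink (A.ψ (d, s)) = A.ψ (d, upperHalf s) :=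
  A.radial_apply _ _ d s

@[simp]
theorem smash_apply (d : D) (s : unitInterval) : A.smash (A.ψ (d, s)) = A.ψ (d, doubleMin s) :=
  A.radial_apply _ _ d s

theorem retract_mem_core (x : X) : A.retract x ∈ A.core := by
  obtain ⟨⟨d, s⟩, rfl⟩ := A.surjective x
  rw [retract_apply]
  exact A.apply_one_mem_core d

theorem shrink_of_mem_core {x : X} (hx : x ∈ A.core) : A.shrink x = x := by
  obtain ⟨⟨d, s⟩, rfl, rfl⟩ := hx
  rw [shrink_apply, upperHalf_one]

theorem smash_shrink (x : X) : A.smash (A.shrink x) = A.retract x := by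
  obtain ⟨⟨d, s⟩, rfl⟩ := A.surjective x
  simp [doubleMin_upperHalf]

theorem exists_low_or_shrink (x : X) :
    (∃ (d : D) (s : unitInterval), (s : ℝ) ≤ 1 / 2 ∧ A.ψ (d, s) = x) ∨ ∃ y, A.shrink y = x := by
  obtain ⟨⟨d, s⟩, rfl⟩ := A.surjective x
  rcases le_total (s : ℝ) (1 / 2) with h | h
  · exact .inl ⟨d, s, h, rfl⟩
  · exact .inr ⟨A.ψ (d, doubleSubOne s), by rw [shrink_apply, upperHalf_doubleSubOne h]⟩

section Squeeze

variable (F : X ≃ₜ X) (hF : ∀ x, x ∈ D ↔ F x ∈ D)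

/-- The continuous map which is conjugate to `F`, by `shrink`, on the image of `shrink`, and which
is the product of `F` and the identity on the remaining collar `ψ (D × [0, 1/2])`. -/
noncomputable def squeezeMap : C(X, X) :=
  A.isQuotientMap.lift
    ⟨fun p => if (p.2 : ℝ) ≤ 1 / 2 then A.ψ (F.subtype hF p.1, p.2)
      else A.shrink (F (A.ψ (p.1, doubleSubOne p.2))), by
      refine Continuous.if_le (by fun_prop) (by fun_prop) (by fun_prop) (by fun_prop) ?_
      rintro ⟨d, s⟩ (h : (s : ℝ) = 1 / 2)
      have h0 : doubleSubOne s = 0 := by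
        ext
        change max (2 * (s : ℝ) - 1) 0 = 0
        norm_num [h]
      have h1 : upperHalf 0 = s := by
        ext
        change (1 + (0 : ℝ)) / 2 = s
        norm_num [h]
      have h2 : F d = A.ψ (F.subtype hF d, 0) := (A.apply_zero (F.subtype hF d)).symm
      simp only [h0, A.apply_zero]
      rw [h2, shrink_apply, h1]⟩ (by
    rintro ⟨d, s⟩ ⟨d', s'⟩ h
    rcases A.eq_or_eq_one _ _ h with h' | ⟨hs, hs'⟩
    · rw [h']
    · obtain rfl : s = 1 := hs
      obtain rfl : s' = 1 := hs'
      have h1 : ¬ ((1 : unitInterval) : ℝ) ≤ 1 / 2 := by norm_num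
      simp only [ContinuousMap.coe_mk, if_neg h1, doubleSubOne_one, h])

theorem squeezeMap_apply (p : D × unitInterval) :
    A.squeezeMap F hF (A.ψ p) = if (p.2 : ℝ) ≤ 1 / 2 then A.ψ (F.subtype hF p.1, p.2)
      else A.shrink (F (A.ψ (p.1, doubleSubOne p.2))) :=
  A.lift_apply _ _ p

theorem squeezeMap_low (d : D) {s : unitInterval} (hs : (s : ℝ) ≤ 1 / 2) :
    A.squeezeMap F hF (A.ψ (d, s)) = A.ψ (F.subtype hF d, s) := by
  rw [squeezeMap_apply, if_pos hs]

theorem squeezeMap_shrink (x : X) : A.squeezeMap F hF (A.shrink x) = A.shrink (F x) := by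
  obtain ⟨⟨d, s⟩, rfl⟩ := A.surjective x
  rw [shrink_apply]
  rcases eq_or_ne s 0 with rfl | hs
  · have h2 : F d = A.ψ (F.subtype hF d, 0) := (A.apply_zero (F.subtype hF d)).symm
    rw [squeezeMap_low _ _ _ _ (by norm_num [upperHalf]), A.apply_zero, h2, shrink_apply]
  · have hs : (0 : ℝ) < s := unitInterval.pos_iff_ne_zero.2 hs
    have h : ¬ (upperHalf s : ℝ) ≤ 1 / 2 := by
      change ¬ (1 + (s : ℝ)) / 2 ≤ 1 / 2
      linarith
    rw [squeezeMap_apply, if_neg h, doubleSubOne_upperHalf]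

theorem squeezeMap_symm_squeezeMap (hF' : ∀ x, x ∈ D ↔ F.symm x ∈ D) (x : X) :
    A.squeezeMap F.symm hF' (A.squeezeMap F hF x) = x := by
  rcases A.exists_low_or_shrink x with ⟨d, s, hs, rfl⟩ | ⟨y, rfl⟩
  · rw [squeezeMap_low _ _ _ _ hs, squeezeMap_low _ _ _ _ hs]
    congr 2
    exact Subtype.ext (F.symm_apply_apply d)
  · rw [squeezeMap_shrink, squeezeMap_shrink, F.symm_apply_apply]

/-- `squeezeMap` as a homeomorphism. -/
noncomputable def squeeze : X ≃ₜ X :=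
  have hF' : ∀ x, x ∈ D ↔ F.symm x ∈ D := fun x => by rw [hF (F.symm x), F.apply_symm_apply]
  { toFun := A.squeezeMap F hF
    invFun := A.squeezeMap F.symm hF'
    left_inv := A.squeezeMap_symm_squeezeMap F hF hF'
    right_inv := A.squeezeMap_symm_squeezeMap F.symm hF' hF
    continuous_toFun := (A.squeezeMap _ _).continuous
    continuous_invFun := (A.squeezeMap _ _).continuous }

/-- The composition of `squeeze` and `smash`. It agrees with `F` on `D`, agrees with `F` followed
by the retraction on the core, and attracts the complement of `D` to the core. -/
noncomputable def collapse : C(X, X) := A.smash.comp (A.squeezeMap F hF)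

theorem collapse_low (d : D) {s : unitInterval} (hs : (s : ℝ) ≤ 1 / 2) :
    A.collapse F hF (A.ψ (d, s)) = A.ψ (F.subtype hF d, doubleMin s) := by
  rw [collapse, ContinuousMap.comp_apply, squeezeMap_low _ _ _ _ hs, smash_apply]

theorem collapse_shrink (x : X) : A.collapse F hF (A.shrink x) = A.retract (F x) := by
  rw [collapse, ContinuousMap.comp_apply, squeezeMap_shrink, smash_shrink]

theorem collapse_of_mem_core {x : X} (hx : x ∈ A.core) :
    A.collapse F hF x = A.retract (F x) := by
  rw [← collapse_shrink A F hF, A.shrink_of_mem_core hx]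

theorem mapsTo_collapse_core : MapsTo (A.collapse F hF) A.core A.core := fun x hx => by
  rw [A.collapse_of_mem_core F hF hx]
  exact A.retract_mem_core _

theorem collapse_of_mem {x : X} (hx : x ∈ D) : A.collapse F hF x = F x := by
  have := A.collapse_low F hF ⟨x, hx⟩ (s := 0) (by norm_num)
  rw [doubleMin_zero, A.apply_zero, A.apply_zero] at this
  exact this

theorem mem_of_collapse_mem {x : X} (hx : A.collapse F hF x ∈ D) : x ∈ D := by
  rcases A.exists_low_or_shrink x with ⟨d, s, hs, rfl⟩ | ⟨y, rfl⟩
  · rw [A.collapse_low F hF d hs, apply_mem_iff] at hx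
    rw [apply_mem_iff]
    have h : (doubleMin s : ℝ) = 0 := congrArg Subtype.val hx
    rw [coe_doubleMin hs] at h
    ext
    change (s : ℝ) = 0
    linarith
  · obtain ⟨⟨d, s⟩, h⟩ := A.surjective (F y)
    rw [collapse_shrink, ← h, retract_apply, apply_mem_iff] at hx
    exact absurd hx one_ne_zero

/-- Each application of `collapse` doubles the radial coordinate until it exceeds `1/2`; the next
application then lands in the core, which is forward invariant. -/
theorem collapse_iterate_mem_core_of_le (N : ℕ) (d : D) {s : unitInterval}
    (hs : (1 / 2 : ℝ) ^ N ≤ s) : (A.collapse F hF)^[N] (A.ψ (d, s)) ∈ A.core := by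
  induction N generalizing d s with
  | zero =>
    obtain rfl : s = 1 := le_antisymm s.2.2 (by rwa [pow_zero] at hs)
    exact A.apply_one_mem_core d
  | succ N ih =>
    rw [Function.iterate_succ_apply]
    rcases le_total (s : ℝ) (1 / 2) with h | h
    · rw [A.collapse_low F hF d h]
      refine ih _ ?_
      rw [coe_doubleMin h]
      rw [pow_succ] at hs
      linarith
    · rw [← upperHalf_doubleSubOne h, ← shrink_apply, collapse_shrink]
      exact (A.mapsTo_collapse_core F hF).iterate N (A.retract_mem_core _)

theorem exists_forall_collapse_iterate_mem_core {x : X} (hx : x ∉ D) :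
    ∃ N, ∀ j ≥ N, (A.collapse F hF)^[j] x ∈ A.core := by
  obtain ⟨⟨d, s⟩, rfl⟩ := A.surjective x
  rw [apply_mem_iff] at hx
  have hs : (0 : ℝ) < s := unitInterval.pos_iff_ne_zero.2 hx
  obtain ⟨N, hN⟩ := exists_pow_lt_of_lt_one hs (by norm_num : (1 / 2 : ℝ) < 1)
  refine ⟨N, fun j hj => A.collapse_iterate_mem_core_of_le F hF j d ?_⟩
  exact (pow_le_pow_of_le_one (by norm_num) (by norm_num) hj).trans hN.le

section Fiber

-- All the maps above respect a partition of `X` which `F` respects and which is constant on rays.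
variable {Y : Type*} {π : X → Y} (hψ : ∀ d s, π (A.ψ (d, s)) = π d)
include hψ

theorem radial_fiber (l : C(unitInterval, unitInterval)) (hl : l 1 = 1) (x : X) :
    π (A.radial l hl x) = π x := by
  obtain ⟨⟨d, s⟩, rfl⟩ := A.surjective x
  rw [radial_apply, hψ, hψ]

theorem squeezeMap_fiber (hπF : ∀ x, π (F x) = π x) (x : X) : π (A.squeezeMap F hF x) = π x := by
  rcases A.exists_low_or_shrink x with ⟨d, s, hs, rfl⟩ | ⟨y, rfl⟩
  · rw [squeezeMap_low _ _ _ _ hs, hψ, hψ]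
    exact hπF d
  · rw [squeezeMap_shrink, shrink, A.radial_fiber hψ, A.radial_fiber hψ, hπF]

theorem collapse_fiber (hπF : ∀ x, π (F x) = π x) (x : X) : π (A.collapse F hF x) = π x := by
  rw [collapse, ContinuousMap.comp_apply, smash, A.radial_fiber hψ,
    A.squeezeMap_fiber F hF hψ hπF]

end Fiber

end Squeeze

end RadialStructure

open unitInterval in
/-- `collapse` is a uniform limit of homeomorphisms, because `doubleMin` is. -/
theorem RadialStructure.exists_homeomorph_dist_collapse_lt {X Y : Type*} [MetricSpace X] {D : Set X}
    [CompactSpace D] (A : RadialStructure D) (F : X ≃ₜ X) (hF : ∀ x, x ∈ D ↔ F x ∈ D)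
    {π : X → Y} (hψ : ∀ d s, π (A.ψ (d, s)) = π d) (hπF : ∀ x, π (F x) = π x)
    {δ : ℝ} (hδ : 0 < δ) :
    ∃ h : X ≃ₜ X, ((∀ x ∈ D, h x = F x) ∧ ∀ x, π (h x) = π x) ∧
      ∀ x, dist (h x) (A.collapse F hF x) < δ := by
  obtain ⟨η, hη, hψη⟩ := Metric.uniformContinuous_iff.1
    (CompactSpace.uniformContinuous_of_continuous A.ψ.continuous) δ hδ
  have hc0 : 0 < min (η / 2) 1 := lt_min (by positivity) one_pos
  let c : unitInterval := ⟨min (η / 2) 1, hc0.le, min_le_right _ _⟩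
  have hc : (c : ℝ) < η := (min_le_left _ _).trans_lt (by linarith)
  refine ⟨(A.squeeze F hF).trans (A.radialHomeomorph (doubleMinHomeomorph (c := c) hc0)
    (doubleMinInterp_one c)), ⟨fun x hx => ?_, fun x => ?_⟩, fun x => ?_⟩
  · change A.radial (doubleMinInterp c) (doubleMinInterp_one c) (A.squeezeMap F hF x) = F x
    have := A.squeezeMap_low F hF ⟨x, hx⟩ (s := 0) (by norm_num)
    rw [A.apply_zero] at this
    rw [this, radial_apply, doubleMinInterp_zero, A.apply_zero]
    rfl
  · exact (A.radial_fiber hψ (doubleMinInterp c) (doubleMinInterp_one c) _).trans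
      (A.squeezeMap_fiber F hF hψ hπF x)
  · change dist (A.radial (doubleMinInterp c) (doubleMinInterp_one c) (A.squeezeMap F hF x))
      (A.smash (A.squeezeMap F hF x)) < δ
    obtain ⟨⟨d, s⟩, h⟩ := A.surjective (A.squeezeMap F hF x)
    rw [← h, radial_apply, smash_apply]
    refine hψη ?_
    rw [Prod.dist_eq, dist_self, max_eq_right dist_nonneg]
    exact (dist_doubleMinInterp_le c s).trans_lt hc

/-! ### Stabilizing maps and periodic points -/

section Stabilization

variable {X : Type*} {f : X → X} {m : ℕ}

theorem InverseLimit.apply_mem_range_iterate (x : InverseLimit f) (m i : ℕ) :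
    x.1 i ∈ range f^[m] := ⟨x.1 (i + m), x.iterate_apply i m⟩

/-- `f` maps the stable image `range f^[m]` onto itself, so every point of it has a backward
orbit. -/
theorem StabilizesAt.exists_inverseLimit_apply_zero (h : StabilizesAt f m) {y : X}
    (hy : y ∈ range f^[m]) : ∃ x : InverseLimit f, x.1 0 = y := by
  have hpre : ∀ z : range f^[m], ∃ w : range f^[m], f w = z := by
    rintro ⟨z, hz⟩
    obtain ⟨u, rfl⟩ : z ∈ range f^[m + 1] := by rwa [h]
    exact ⟨⟨f^[m] u, u, rfl⟩, (Function.iterate_succ_apply' f m u).symm⟩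
  choose p hp using hpre
  refine ⟨⟨fun i => (p^[i] ⟨y, hy⟩ : range f^[m]), fun i => ?_⟩, rfl⟩
  simp only [Function.iterate_succ_apply', hp]

theorem StabilizesAt.exists_inverseLimit_apply [TopologicalSpace X] {f : C(X, X)}
    (h : StabilizesAt f m) {y : X} (hy : y ∈ range f^[m]) (i : ℕ) :
    ∃ x : InverseLimit f, x.1 i = y := by
  obtain ⟨x, rfl⟩ := h.exists_inverseLimit_apply_zero hy
  refine ⟨(naturalExtension f)^[i] x, ?_⟩
  have := x.iterate_apply 0 i
  rw [zero_add] at this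
  rw [naturalExtension_iterate_apply, this]

end Stabilization

section Periodic

variable {X : Type*} [TopologicalSpace X] (f : C(X, X))

/-- A periodic point of the natural extension is determined by its coordinate `0`, since its other
coordinates are the points of a periodic orbit traversed backwards. -/
theorem bijOn_periodicPts_naturalExtension :
    BijOn (fun x : InverseLimit f => x.1 0) (Function.periodicPts (naturalExtension f))
      (Function.periodicPts f) := by
  have hcoord {k : ℕ} {x : InverseLimit f} (hx : Function.IsPeriodicPt (naturalExtension f) k x)
      (i : ℕ) : Function.IsPeriodicPt f k (x.1 i) := by
    have : ((naturalExtension f)^[k] x).1 i = x.1 i := congrArg (fun y : InverseLimit f => y.1 i) hx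
    rwa [naturalExtension_iterate_apply] at this
  refine ⟨?_, ?_, ?_⟩
  · rintro x ⟨k, hk, hx⟩
    exact ⟨k, hk, hcoord hx 0⟩
  · rintro x ⟨k, hk, hx⟩ y ⟨l, hl, hy⟩ (hxy : x.1 0 = y.1 0)
    refine Subtype.ext (funext fun i => ?_)
    have hle : i ≤ k * l * i := Nat.le_mul_of_pos_left i (Nat.mul_pos hk hl)
    have key (z : InverseLimit f) (hz : Function.IsPeriodicPt f (k * l) (z.1 i)) :
        z.1 i = f^[k * l * i - i] (z.1 0) := by
      have h1 := z.iterate_apply 0 i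
      rw [zero_add] at h1
      rw [← h1, ← Function.iterate_add_apply, Nat.sub_add_cancel hle]
      exact (hz.mul_const i).eq.symm
    rw [key x ((hcoord hx i).mul_const l), key y ((hcoord hy i).const_mul k), hxy]
  · rintro p ⟨k, hk, hp⟩
    refine ⟨⟨fun i => f^[(k - 1) * i] p, fun i => ?_⟩, ⟨k, hk, ?_⟩, rfl⟩
    · rw [← Function.iterate_succ_apply' f,
        show ((k - 1) * (i + 1)).succ = (k - 1) * i + k by rw [mul_add]; omega,
        Function.iterate_add_apply, hp.eq]
    · refine Subtype.ext (funext fun i => ?_)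
      rw [naturalExtension_iterate_apply]
      exact (hp.apply_iterate _).eq

end Periodic

/-- The sets of points whose coordinate at a single large index lies in a given neighbourhood form
a neighbourhood basis in the inverse limit, because this coordinate determines those before it. -/
theorem InverseLimit.exists_forall_apply_mem_imp_mem {X : Type*} [TopologicalSpace X] {f : C(X, X)}
    (x : InverseLimit f) {V : Set (InverseLimit f)} (hV : V ∈ 𝓝 x) :
    ∃ N, ∃ W ∈ 𝓝 (x.1 N), ∀ y : InverseLimit f, y.1 N ∈ W → y ∈ V := by
  obtain ⟨U, hU, hUV⟩ := mem_nhds_subtype _ _ _ |>.1 hV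
  obtain ⟨U', hU'U, hU', hxU'⟩ := mem_nhds_iff.1 hU
  obtain ⟨J, u, hu, hJ⟩ := isOpen_pi_iff.1 hU' x.1 hxU'
  have hcoord (y : InverseLimit f) (j : ℕ) (hj : j ∈ J) :
      f^[J.sup id - j] (y.1 (J.sup id)) = y.1 j := by
    have hle : j ≤ J.sup id := Finset.le_sup (f := id) hj
    have := y.iterate_apply j (J.sup id - j)
    rwa [Nat.add_sub_cancel' hle] at this
  refine ⟨J.sup id, ⋂ j ∈ J, f^[J.sup id - j] ⁻¹' u j, ?_, fun y hy => hUV (hU'U (hJ ?_))⟩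
  · refine (Filter.biInter_finset_mem J).2 fun j hj => ?_
    refine (f.continuous.iterate _).continuousAt.preimage_mem_nhds ?_
    rw [hcoord x j hj]
    exact (hu j hj).1.mem_nhds (hu j hj).2
  · intro j hj
    rw [← hcoord y j hj]
    exact mem_iInter₂.1 hy j hj

/-- A homeomorphism of the inverse limit of `collapse` with `X` which is close to the projection to
the coordinate `0`, and equal to it over `D` because the approximating homeomorphisms, like
`collapse` itself, agree with `F` on `D`. -/
theorem RadialStructure.exists_homeomorph_inverseLimit_collapse {X Y : Type*} [MetricSpace X]
    [CompactSpace X] {D : Set X} [CompactSpace D] (A : RadialStructure D) (F : X ≃ₜ X)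
    (hF : ∀ x, x ∈ D ↔ F x ∈ D) [TopologicalSpace Y] [T2Space Y] {π : X → Y} (hπ : Continuous π)
    (hψ : ∀ d s, π (A.ψ (d, s)) = π d) (hπF : ∀ x, π (F x) = π x) {ε : ℝ} (hε : 0 < ε) :
    ∃ β : InverseLimit (A.collapse F hF) ≃ₜ X, (∀ x, dist (β x) (x.1 0) < ε) ∧
      (∀ x, π (β x) = π (x.1 0)) ∧ ∀ x, x.1 0 ∈ D → β x = x.1 0 := by
  obtain ⟨c, β, hc0, hcP, hβ, hlim⟩ := exists_homeomorph_inverseLimit (A.collapse F hF)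
    (fun δ hδ => A.exists_homeomorph_dist_collapse_lt F hF hψ hπF hδ) hε
  have hcπ (i : ℕ) (x : X) : π (c i x) = π x := by
    induction i generalizing x with
    | zero => rw [hc0]; rfl
    | succ i ih =>
      obtain ⟨h, hh, hc⟩ := hcP i
      rw [hc, Homeomorph.trans_apply, ih, hh.2]
  have hcD (i : ℕ) (x : X) (hx : x ∈ D) : c i x = (A.collapse F hF)^[i] x := by
    induction i generalizing x with
    | zero => rw [hc0]; rfl
    | succ i ih =>
      obtain ⟨h, hh, hc⟩ := hcP i
      rw [hc, Homeomorph.trans_apply, hh.1 x hx, ih _ ((hF x).1 hx), Function.iterate_succ_apply,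
        A.collapse_of_mem F hF hx]
  refine ⟨β, hβ, fun x => ?_, fun x hx => ?_⟩
  · refine tendsto_nhds_unique ((hπ.tendsto _).comp (hlim x)) (tendsto_const_nhds.congr fun i => ?_)
    rw [Function.comp_apply, hcπ]
    induction i with
    | zero => rfl
    | succ i ih => rw [ih, ← x.2 i, A.collapse_fiber F hF hψ hπF]
  · have hx0 (i : ℕ) : x.1 i ∈ D := by
      induction i with
      | zero => exact hx
      | succ i ih =>
        rw [← x.2 i] at ih
        exact A.mem_of_collapse_mem F hF ih
    refine tendsto_nhds_unique (hlim x) (tendsto_const_nhds.congr fun i => ?_)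
    have := x.iterate_apply 0 i
    rw [zero_add] at this
    rw [hcD i _ (hx0 i), this]

/-! ### Topological invariance of the boundary -/

section Boundary

variable {n : ℕ} {M : Type*} [TopologicalSpace M]

theorem isClosed_manifoldBoundary (n : ℕ) (M : Type*) [TopologicalSpace M] :
    IsClosed (manifoldBoundary n M) := by
  rw [← isOpen_compl_iff, isOpen_iff_mem_nhds]
  intro x hx
  obtain ⟨e, he⟩ := not_not.1 hx
  filter_upwards [e.open_source.mem_nhds he] with y hy
  exact fun h => h ⟨e, hy⟩

theorem mem_manifoldBoundary_of_homeomorph_mem (F : M ≃ₜ M) {x : M}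
    (hx : F x ∈ manifoldBoundary n M) : x ∈ manifoldBoundary n M := by
  rintro ⟨e, he⟩
  exact hx ⟨F.symm.toOpenPartialHomeomorph.trans e, by simpa using he⟩

theorem mem_manifoldBoundary_iff_homeomorph (F : M ≃ₜ M) (x : M) :
    x ∈ manifoldBoundary n M ↔ F x ∈ manifoldBoundary n M :=
  ⟨fun h => mem_manifoldBoundary_of_homeomorph_mem F.symm (by rwa [F.symm_apply_apply]),
    mem_manifoldBoundary_of_homeomorph_mem F⟩

end Boundary

/-! ### Families of homeomorphisms -/

section Fibered

variable {I M : Type*} [TopologicalSpace I] [TopologicalSpace M]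

/-- The homeomorphism `(t, x) ↦ (t, F t x)` of `I × M` given by a continuous family `F` of
homeomorphisms. The inverse is continuous by compactness. -/
noncomputable def Homeomorph.ofFamily [CompactSpace I] [T2Space I] [CompactSpace M] [T2Space M]
    (F : I → M ≃ₜ M) (hF : Continuous fun t => (F t : C(M, M))) : I × M ≃ₜ I × M :=
  Continuous.homeoOfEquivCompactToT2
    (f := { toFun := fun p => (p.1, F p.1 p.2)
            invFun := fun p => (p.1, (F p.1).symm p.2)
            left_inv := fun p => by simp
            right_inv := fun p => by simp })
    (continuous_fst.prodMk ((hF.comp continuous_fst).eval continuous_snd))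

/-- The restriction of a fibered homeomorphism of `I × M` to the fiber over `t`. -/
noncomputable def Homeomorph.fiber (G : I × M ≃ₜ I × M) (hG : ∀ p, (G p).1 = p.1) (t : I) :
    M ≃ₜ M :=
  have hG' (p : I × M) : (G.symm p).1 = p.1 := by rw [← hG (G.symm p), G.apply_symm_apply]
  { toFun := fun x => (G (t, x)).2
    invFun := fun x => (G.symm (t, x)).2
    left_inv := fun x => by
      have : (t, (G (t, x)).2) = G (t, x) := Prod.ext (hG (t, x)).symm rfl
      simp only [this, G.symm_apply_apply]
    right_inv := fun x => by
      have : (t, (G.symm (t, x)).2) = G.symm (t, x) := Prod.ext (hG' (t, x)).symm rfl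
      simp only [this, G.apply_symm_apply]
    continuous_toFun := by fun_prop
    continuous_invFun := by fun_prop }

variable {G : I × M ≃ₜ I × M} {hG : ∀ p, (G p).1 = p.1}

theorem Homeomorph.fiber_apply (t : I) (x : M) : (t, G.fiber hG t x) = G (t, x) :=
  Prod.ext (hG (t, x)).symm rfl

theorem Homeomorph.fiber_iterate_apply (t : I) (k : ℕ) (x : M) :
    (t, (G.fiber hG t)^[k] x) = G^[k] (t, x) := by
  induction k with
  | zero => rfl
  | succ k ih => rw [Function.iterate_succ_apply', fiber_apply, ih, Function.iterate_succ_apply']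

theorem Homeomorph.continuous_fiber :
    Continuous fun t => (G.fiber hG t : C(M, M)) :=
  ContinuousMap.continuous_of_continuous_uncurry _ (continuous_snd.comp G.continuous)

end Fibered

/-! ### Boundary retracts with parameters -/

namespace BoundaryRetract

variable {n : ℕ} {M : Type*} [TopologicalSpace M] {E : Set M} (B : BoundaryRetract n E)

theorem eq_or_eq_one (p q : manifoldBoundary n M × unitInterval) (h : B.Ψ p = B.Ψ q) :
    p = q ∨ p.2 = 1 ∧ q.2 = 1 := by
  have hlt {p : manifoldBoundary n M × unitInterval} (hp : p.2 < 1) : B.Ψ p ∉ E :=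
    B.image_lt_one.subset ⟨p, hp, rfl⟩
  have hone {p : manifoldBoundary n M × unitInterval} (hp : p.2 = 1) : B.Ψ p ∈ E :=
    B.image_one.subset ⟨p, hp, rfl⟩
  rcases unitInterval.le_one'.lt_or_eq (a := p.2) with hp | hp <;>
    rcases unitInterval.le_one'.lt_or_eq (a := q.2) with hq | hq
  · exact .inl (congrArg Subtype.val (@B.isEmbedding.injective ⟨p, hp⟩ ⟨q, hq⟩ h))
  · exact absurd (h ▸ hone hq) (hlt hp)
  · exact absurd (h ▸ hone hp) (hlt hq)
  · exact .inr ⟨hp, hq⟩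

/-- The product of the collar structure of a boundary retract with a parameter space `I`. -/
noncomputable def prodRadialStructure (I : Type*) [TopologicalSpace I] :
    RadialStructure (Prod.snd ⁻¹' manifoldBoundary n M : Set (I × M)) where
  ψ := ⟨fun p => (p.1.1.1, B.Ψ (⟨p.1.1.2, p.1.2⟩, p.2)), by fun_prop⟩
  apply_zero d := Prod.ext rfl (B.apply_zero _)
  surjective := by
    rintro ⟨t, x⟩
    obtain ⟨⟨η, s⟩, rfl⟩ := B.surjective x
    exact ⟨(⟨(t, η), η.2⟩, s), rfl⟩
  eq_or_eq_one := by
    rintro ⟨⟨⟨t, η⟩, hη⟩, s⟩ ⟨⟨⟨t', η'⟩, hη'⟩, s'⟩ h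
    obtain rfl : t = t' := congrArg Prod.fst h
    rcases B.eq_or_eq_one (⟨η, hη⟩, s) (⟨η', hη'⟩, s') (congrArg Prod.snd h) with h' | h'
    · obtain ⟨h1, rfl⟩ := Prod.mk.inj h'
      obtain rfl : η = η' := congrArg Subtype.val h1
      exact .inl rfl
    · exact .inr h'

theorem prodRadialStructure_apply (I : Type*) [TopologicalSpace I] (t : I)
    (η : manifoldBoundary n M) (s : unitInterval) :
    (B.prodRadialStructure I).ψ (⟨(t, η), η.2⟩, s) = (t, B.Ψ (η, s)) := rfl

theorem core_prodRadialStructure (I : Type*) [TopologicalSpace I] :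
    (B.prodRadialStructure I).core = Prod.snd ⁻¹' E := by
  ext ⟨t, x⟩
  constructor
  · rintro ⟨⟨d, s⟩, hs, h⟩
    rw [mem_preimage, ← h]
    exact B.image_one.subset ⟨(⟨d.1.2, d.2⟩, s), hs, rfl⟩
  · rintro (hx : x ∈ E)
    obtain ⟨⟨η, s⟩, hs, rfl⟩ := B.image_one.superset hx
    exact ⟨(⟨(t, η), η.2⟩, s), hs, rfl⟩

theorem retract_prodRadialStructure [CompactSpace M] [T2Space M] (I : Type*) [TopologicalSpace I]
    [T2Space I] [CompactSpace (Prod.snd ⁻¹' manifoldBoundary n M : Set (I × M))] (t : I) (x : M) :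
    (B.prodRadialStructure I).retract (t, x) = (t, (B.retraction x : M)) := by
  obtain ⟨⟨η, s⟩, rfl⟩ := B.surjective x
  rw [B.retraction_apply, ← prodRadialStructure_apply, RadialStructure.retract_apply]
  rfl

theorem isCompact [CompactSpace M] (B : BoundaryRetract n E) : IsCompact E := by
  have := isCompact_iff_compactSpace.1 (isClosed_manifoldBoundary n M).isCompact
  rw [← B.image_one]
  exact (isClosed_eq continuous_snd continuous_const).isCompact.image B.Ψ.continuous

end BoundaryRetract

/-! ### The attractors and their continuity -/

section FiberInverseLimit

variable {I M : Type*} [TopologicalSpace I] [TopologicalSpace M] {E : Set M} {f : I → C(E, E)}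
  {H : C(I × M, I × M)}

/-- The embedding of the inverse limit of `f t`, regarded as a self-map of `{t} × E`, into that
of an extension `H` of all these maps. -/
def InverseLimit.inclusion (hH : ∀ t (e : E), H (t, e) = (t, (f t e : M))) (t : I)
    (x : InverseLimit (f t)) : InverseLimit H :=
  ⟨fun i => (t, x.1 i), fun i => by rw [hH, x.2]⟩

variable (hH : ∀ t (e : E), H (t, e) = (t, (f t e : M)))

theorem InverseLimit.inclusion_injective (t : I) :
    Function.Injective (inclusion hH t) := fun _ _ h =>
  Subtype.ext (funext fun i => Subtype.ext
    (congrArg (fun z : InverseLimit H => (z.1 i).2) h))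

theorem InverseLimit.mem_range_inclusion_iff (t : I) (y : InverseLimit H) :
    y ∈ range (inclusion hH t) ↔ (y.1 0).1 = t ∧ ∀ i, (y.1 i).2 ∈ E := by
  constructor
  · rintro ⟨x, rfl⟩
    exact ⟨rfl, fun i => (x.1 i).2⟩
  · rintro ⟨rfl, hE⟩
    have hH' (i : ℕ) : H (y.1 (i + 1)) = ((y.1 (i + 1)).1, (f _ ⟨_, hE (i + 1)⟩ : M)) :=
      hH (y.1 (i + 1)).1 ⟨_, hE (i + 1)⟩
    have ht (i : ℕ) : (y.1 i).1 = (y.1 0).1 := by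
      induction i with
      | zero => rfl
      | succ i ih => rw [← ih, ← y.2 i, hH']
    refine ⟨⟨fun i => ⟨(y.1 i).2, hE i⟩, fun i => Subtype.ext ?_⟩, ?_⟩
    · have := (hH' i).symm.trans (y.2 i)
      rw [ht (i + 1)] at this
      exact congrArg Prod.snd this
    · exact Subtype.ext (funext fun i => Prod.ext (ht i).symm rfl)

theorem InverseLimit.continuous_inclusion (t : I) :
    Continuous (inclusion hH t) :=
  Continuous.subtype_mk (continuous_pi fun i => continuous_const.prodMk
    (continuous_subtype_val.comp ((continuous_apply i).comp continuous_subtype_val))) _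

theorem naturalExtension_inclusion (t : I) (x : InverseLimit (f t)) :
    naturalExtension H (InverseLimit.inclusion hH t x) =
      InverseLimit.inclusion hH t (naturalExtension (f t) x) := by
  refine Subtype.ext (funext fun i => ?_)
  rw [naturalExtension_apply]
  change H (t, (x.1 i : M)) = (t, (((naturalExtension (f t) x).1 i : E) : M))
  rw [naturalExtension_apply, hH]

/-- The embedding of the inverse limit of `f t` into the fiber `M` over `t` which is induced by a
homeomorphism `β` of the inverse limit of `H` with `I × M`. -/
def InverseLimit.fiberEmbedding (β : InverseLimit H ≃ₜ I × M) (t : I)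
    (x : InverseLimit (f t)) : M :=
  (β (inclusion hH t x)).2

variable {β : InverseLimit H ≃ₜ I × M} (hβ : ∀ x, (β x).1 = (x.1 0).1)
include hβ

theorem InverseLimit.mk_fiberEmbedding (t : I) (x : InverseLimit (f t)) :
    (t, fiberEmbedding hH β t x) = β (inclusion hH t x) :=
  Prod.ext (hβ (inclusion hH t x)).symm rfl

theorem InverseLimit.isClosedEmbedding_fiberEmbedding [T2Space M] [CompactSpace E] (t : I) :
    IsClosedEmbedding (fiberEmbedding hH β t) :=
  (continuous_snd.comp (β.continuous.comp (continuous_inclusion hH t))).isClosedEmbedding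
    fun x y h => inclusion_injective hH t (β.injective (by
      rw [← mk_fiberEmbedding hH hβ, ← mk_fiberEmbedding hH hβ]
      exact congrArg (Prod.mk t) h))

theorem InverseLimit.mem_range_fiberEmbedding_iff (t : I) (z : M) :
    z ∈ range (fiberEmbedding hH β t) ↔ ∀ i, ((β.symm (t, z)).1 i).2 ∈ E := by
  have h1 : ((β.symm (t, z)).1 0).1 = t := by rw [← hβ, β.apply_symm_apply]
  have h2 := mem_range_inclusion_iff hH t (β.symm (t, z))
  rw [and_iff_right h1] at h2
  rw [← h2]
  constructor
  · rintro ⟨x, rfl⟩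
    exact ⟨x, by rw [mk_fiberEmbedding hH hβ, β.symm_apply_apply]⟩
  · rintro ⟨x, hx⟩
    exact ⟨x, by rw [fiberEmbedding, hx, β.apply_symm_apply]⟩

/-- The images of the inverse limits of `f t` vary upper semicontinuously because together they
form a compact subset of `I × M`, and lower semicontinuously because every point of the image of
`(f t)^[m]`, which varies continuously with `t`, is any prescribed coordinate of some point of the
inverse limit. -/
theorem InverseLimit.continuous_of_coe_eq_range_fiberEmbedding [CompactSpace I] [CompactSpace M]
    [T2Space I] [T2Space M] [CompactSpace E] (hf : Continuous f) {m : ℕ}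
    (hstab : ∀ t, StabilizesAt (f t) m) {Λ : I → TopologicalSpace.NonemptyCompacts M}
    (hΛ : ∀ t, (Λ t : Set M) = range (fiberEmbedding hH β t)) : Continuous Λ := by
  let := TopologicalSpace.vietoris M
  have hmem (t : I) (z : M) : z ∈ (Λ t : Set M) ↔ ∀ i, ((β.symm (t, z)).1 i).2 ∈ E := by
    rw [hΛ, mem_range_fiberEmbedding_iff hH hβ]
  rw [TopologicalSpace.NonemptyCompacts.isEmbedding_coe.continuous_iff,
    TopologicalSpace.vietoris.continuous_iff]
  refine ⟨fun U hU => ?_, fun C hC => ?_⟩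
  · have hclosed : IsClosed {p : I × M | (∀ i, ((β.symm p).1 i).2 ∈ E) ∧ p.2 ∉ U} := by
      have hcl : IsClosed {p : I × M | ∀ i, ((β.symm p).1 i).2 ∈ E} := by
        have : {p : I × M | ∀ i, ((β.symm p).1 i).2 ∈ E} =
            ⋂ i, (fun p : I × M => ((β.symm p).1 i).2) ⁻¹' E := by
          ext; simp
        rw [this]
        have hE : IsClosed E := (isCompact_iff_compactSpace.2 ‹_›).isClosed
        refine isClosed_iInter fun i => hE.preimage ?_
        exact continuous_snd.comp ((continuous_apply i).comp
          (continuous_subtype_val.comp β.symm.continuous))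
      exact hcl.inter (hU.isClosed_compl.preimage continuous_snd)
    rw [← isClosed_compl_iff]
    convert (hclosed.isCompact.image continuous_fst).isClosed using 1
    ext t
    simp only [mem_compl_iff, mem_preimage, mem_powerset_iff, Function.comp_apply, not_subset, hmem,
      mem_image, Prod.exists, exists_and_right, exists_eq_right]
    rfl
  · rw [← isOpen_compl_iff, isOpen_iff_mem_nhds]
    intro t ht
    obtain ⟨z, hz, hzC⟩ := not_subset.1 (show ¬ (Λ t : Set M) ⊆ C from ht)
    rw [hΛ] at hz
    obtain ⟨x, rfl⟩ := hz
    have hV : {y : InverseLimit H | (β y).2 ∉ C} ∈ 𝓝 (inclusion hH t x) :=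
      (hC.isOpen_compl.preimage (continuous_snd.comp β.continuous)).mem_nhds hzC
    obtain ⟨N, W, hW, hNW⟩ := (inclusion hH t x).exists_forall_apply_mem_imp_mem hV
    obtain ⟨e, he⟩ := x.apply_mem_range_iterate m N
    have hcont : Continuous fun s => (s, ((f s)^[m] e : M)) := by
      refine continuous_id.prodMk (continuous_subtype_val.comp ?_)
      clear hstab he
      induction m with
      | zero => exact continuous_const
      | succ m ih =>
        simp only [Function.iterate_succ_apply']
        exact hf.eval ih
    have hWt : W ∈ 𝓝 (t, ((f t)^[m] e : M)) := by rwa [he]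
    filter_upwards [hcont.continuousAt.preimage_mem_nhds hWt] with s hs hsub
    obtain ⟨y, hy⟩ := (hstab s).exists_inverseLimit_apply ⟨e, rfl⟩ N
    refine hNW (inclusion hH s y) ?_ (hsub ?_)
    · change (s, (y.1 N : M)) ∈ W
      rwa [hy]
    · change fiberEmbedding hH β s y ∈ (Λ s : Set M)
      rw [hΛ]
      exact mem_range_self y

end FiberInverseLimit

/-! ### The attractors in the parameterized family -/

theorem theorem3p1
    {n : ℕ} [NeZero n]
    -- `M` is a compact (metric) `n`-manifold with non-empty boundary
    {M : Type*} [MetricSpace M] [CompactSpace M] [ChartedSpace (EuclideanHalfSpace n) M]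
    (hM : (manifoldBoundary n M).Nonempty)
    -- `E` is a boundary retract of `M`
    {E : Set M} (B : BoundaryRetract n E)
    -- the parameter space is a compact metric space
    {I : Type*} [MetricSpace I] [CompactSpace I]
    -- a continuous family in `C(E, E)`, which unwraps in `M`
    (f : I → C(E, E)) (hf : Continuous f)
    (F : I → M ≃ₜ M) (hF : Continuous fun t => (F t : C(M, M)))
    (hunwrap : ∀ t, B.IsUnwrapping (f t) (F t))
    -- and which stabilizes at a common iterate
    (m : ℕ) (hstab : ∀ t, StabilizesAt (f t) m)
    (ε : ℝ) (hε : 0 < ε) :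
    ∃ (Φ : I → M ≃ₜ M) (Λ : I → TopologicalSpace.NonemptyCompacts M) (g : I → C(M, M)),
      Continuous (fun t => (Φ t : C(M, M))) ∧
      -- (a) invariance, and
      (∀ t, Φ t '' (Λ t : Set M) = Λ t) ∧
      -- (i) conjugacy with the natural extension
      (∀ t, ∃ θ : InverseLimit (f t) ≃ₜ (Λ t : Set M),
        ∀ x, (θ (naturalExtension (f t) x) : M) = Φ t (θ x)) ∧
      -- (ii) omega-limit sets
      (∀ t, ∀ x ∈ (manifoldBoundary n M)ᶜ,
        omegaLimit atTop (fun (j : ℕ) (y : M) => (Φ t)^[j] y) {x} ⊆ (Λ t : Set M)) ∧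
      -- (iii) a power is the identity on the boundary; any exponent of the unwrapping will do
      (∀ t, ∃ k : ℕ, 0 < k ∧ ∀ x ∈ manifoldBoundary n M, (Φ t)^[k] x = x) ∧
      (∀ t, ∀ k : ℕ, (∀ x ∈ manifoldBoundary n M, (F t)^[k] x = x) →
        ∀ x ∈ manifoldBoundary n M, (Φ t)^[k] x = x) ∧
      -- (b) the semiconjugacies
      Continuous g ∧
      (∀ t, dist (g t) (ContinuousMap.id M) < ε) ∧
      (∀ t, g t '' (Λ t : Set M) = Subtype.val '' range (f t)^[m]) ∧
      (∀ t, ∀ x ∈ Λ t, ∃ y : E, (y : M) = g t x ∧ (f t y : M) = g t (Φ t x)) ∧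
      -- (c) periodic points
      (∀ t, BijOn (g t) {x | x ∈ Λ t ∧ x ∈ Function.periodicPts (Φ t)}
        (Subtype.val '' Function.periodicPts (f t))) ∧
      -- (d) continuity for the Hausdorff metric
      Continuous Λ := by
  have : Nonempty (manifoldBoundary n M) := hM.to_subtype
  have hcomp : CompactSpace (Prod.snd ⁻¹' manifoldBoundary n M : Set (I × M)) :=
    isCompact_iff_compactSpace.1
      ((isClosed_manifoldBoundary n M).preimage continuous_snd).isCompact
  have hEc : CompactSpace E := isCompact_iff_compactSpace.1 B.isCompact
  have hEne : Nonempty E :=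
    ⟨B.retraction (Classical.arbitrary (manifoldBoundary n M) : M)⟩
  -- The whole family is treated as a single system on the compact space `I × M`, fibered over `I`.
  let A := B.prodRadialStructure I
  let G : I × M ≃ₜ I × M := Homeomorph.ofFamily F hF
  have hGapply (t : I) (x : M) : G (t, x) = (t, F t x) := rfl
  have hGD (p : I × M) :
      p ∈ Prod.snd ⁻¹' manifoldBoundary n M ↔ G p ∈ Prod.snd ⁻¹' manifoldBoundary n M :=
    mem_manifoldBoundary_iff_homeomorph (F p.1) p.2
  let H := A.collapse G hGD
  have hcore : A.core = Prod.snd ⁻¹' E := B.core_prodRadialStructure I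
  have hH (t : I) (e : E) : H (t, (e : M)) = (t, (f t e : M)) := by
    have he : (t, (e : M)) ∈ A.core := by rw [hcore]; exact e.2
    refine (A.collapse_of_mem_core G hGD he).trans ?_
    rw [hGapply, ← (hunwrap t).1 e]
    exact B.retract_prodRadialStructure I t (F t e)
  obtain ⟨β, hβdist, hβfst, hβD⟩ := A.exists_homeomorph_inverseLimit_collapse G hGD
    continuous_fst (fun _ _ => rfl) (fun _ => rfl) hε
  have hHfst (p : I × M) : (H p).1 = p.1 :=
    A.collapse_fiber G hGD (π := Prod.fst) (fun _ _ => rfl) (fun _ => rfl) p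
  let Ω : I × M ≃ₜ I × M := β.symm.trans ((naturalExtension H).trans β)
  have hΩfst (p : I × M) : (Ω p).1 = p.1 := by
    change (β (naturalExtension H (β.symm p))).1 = p.1
    rw [hβfst, naturalExtension_apply, hHfst, ← hβfst, β.apply_symm_apply]
  let Φ : I → M ≃ₜ M := Ω.fiber hΩfst
  have hΩ (x : InverseLimit H) : Ω (β x) = β (naturalExtension H x) := by
    change β (naturalExtension H (β.symm (β x))) = _
    rw [β.symm_apply_apply]
  have hΩiter (j : ℕ) (p : I × M) : β.symm (Ω^[j] p) = (naturalExtension H)^[j] (β.symm p) := by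
    induction j with
    | zero => rfl
    | succ j ih =>
      rw [Function.iterate_succ_apply', Function.iterate_succ_apply', ← ih]
      exact β.symm_apply_apply _
  -- `φ t` identifies the inverse limit of `f t` with the attractor `Λ t`.
  let φ : ∀ t, InverseLimit (f t) → M := InverseLimit.fiberEmbedding hH β
  have hφemb (t : I) : IsClosedEmbedding (φ t) :=
    InverseLimit.isClosedEmbedding_fiberEmbedding hH hβfst t
  have hφ (t : I) (x : InverseLimit (f t)) : (t, φ t x) = β (InverseLimit.inclusion hH t x) :=
    InverseLimit.mk_fiberEmbedding hH hβfst t x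
  have hφmem (t : I) (z : M) : z ∈ range (φ t) ↔ ∀ i, ((β.symm (t, z)).1 i).2 ∈ E :=
    InverseLimit.mem_range_fiberEmbedding_iff hH hβfst t z
  have hφconj (t : I) (x : InverseLimit (f t)) :
      φ t (naturalExtension (f t) x) = Φ t (φ t x) := by
    have : (t, φ t (naturalExtension (f t) x)) = (t, Φ t (φ t x)) := by
      rw [hφ, Homeomorph.fiber_apply, hφ, hΩ, naturalExtension_inclusion]
    exact (Prod.mk.inj this).2
  have hφiter (t : I) (k : ℕ) (x : InverseLimit (f t)) :
      φ t ((naturalExtension (f t))^[k] x) = (Φ t)^[k] (φ t x) :=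
    (Function.Semiconj.iterate_right (f := φ t) (hφconj t) k) x
  have hne (t : I) : (range (φ t)).Nonempty := by
    obtain ⟨x, -⟩ := (hstab t).exists_inverseLimit_apply_zero
      ⟨Classical.arbitrary E, rfl⟩
    exact ⟨φ t x, x, rfl⟩
  let Λ : I → TopologicalSpace.NonemptyCompacts M := fun t =>
    ⟨⟨range (φ t), isCompact_range (hφemb t).continuous⟩, hne t⟩
  have hcontg : Continuous fun p : I × M => ((β.symm p).1 0).2 :=
    continuous_snd.comp ((continuous_apply 0).comp
      (continuous_subtype_val.comp β.symm.continuous))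
  let g : I → C(M, M) := fun t =>
    ⟨fun z => ((β.symm (t, z)).1 0).2, hcontg.comp (Continuous.prodMk_right t)⟩
  have hgφ (t : I) (x : InverseLimit (f t)) : g t (φ t x) = x.1 0 := by
    change ((β.symm (t, φ t x)).1 0).2 = x.1 0
    rw [hφ, β.symm_apply_apply]
    rfl
  have hΦbd (t : I) (x : M) (hx : x ∈ manifoldBoundary n M) : Φ t x = F t x := by
    -- The backward `G`-orbit of `(t, x)` stays in the boundary, where `H` agrees with `G`.
    let b : InverseLimit H := ⟨fun i => G.symm^[i] (t, x), fun i => by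
      have hmem (j : ℕ) : G.symm^[j] (t, x) ∈ Prod.snd ⁻¹' manifoldBoundary n M := by
        induction j with
        | zero => exact hx
        | succ j ih =>
          rw [hGD, Function.iterate_succ_apply', G.apply_symm_apply]
          exact ih
      refine (A.collapse_of_mem G hGD (hmem (i + 1))).trans ?_
      rw [Function.iterate_succ_apply', G.apply_symm_apply]⟩
    have hb : β b = (t, x) := hβD b hx
    have hb' : (naturalExtension H b).1 0 = G (t, x) :=
      A.collapse_of_mem G hGD (x := (t, x)) hx
    have : (t, Φ t x) = G (t, x) := by
      rw [Homeomorph.fiber_apply, ← hb, hΩ, hβD _ (by rw [hb']; exact (hGD _).1 hx), hb', hb]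
    exact congrArg Prod.snd this
  have hΦiter (t : I) (k : ℕ) (x : M) (hx : x ∈ manifoldBoundary n M) :
      (Φ t)^[k] x = (F t)^[k] x := by
    induction k generalizing x with
    | zero => rfl
    | succ k ih =>
      rw [Function.iterate_succ_apply, Function.iterate_succ_apply, hΦbd t x hx,
        ih _ ((mem_manifoldBoundary_iff_homeomorph (F t) x).1 hx)]
  refine ⟨Φ, Λ, g, Homeomorph.continuous_fiber, fun t => ?_, fun t => ?_, fun t x hx => ?_,
    fun t => ?_, fun t k hk x hx => ?_, ?_, fun t => ?_, fun t => ?_, fun t => ?_, fun t => ?_, ?_⟩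
  · change Φ t '' range (φ t) = range (φ t)
    rw [← range_comp, ← (naturalExtension (f t)).surjective.range_comp (φ t)]
    exact congrArg range (funext fun x => (hφconj t x).symm)
  · exact ⟨(hφemb t).isEmbedding.toHomeomorph, hφconj t⟩
  · intro w hw
    refine (hφmem t w).2 fun i => ?_
    -- All coordinates of `β.symm (t, x)` lie off the boundary, so each of them is eventually mapped
    -- into `E` by the iterates of `H`, which act coordinatewise.
    have hy0 : (β.symm (t, x)).1 0 ∉ Prod.snd ⁻¹' manifoldBoundary n M := fun h => hx <| by
      have := hβD _ h
      rw [β.apply_symm_apply] at this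
      rwa [← this] at h
    have hyi : (β.symm (t, x)).1 i ∉ Prod.snd ⁻¹' manifoldBoundary n M := by
      induction i with
      | zero => exact hy0
      | succ i ih =>
        intro h
        refine ih ?_
        rw [← (β.symm (t, x)).2 i]
        refine (A.collapse_of_mem G hGD h).symm ▸ (hGD _).1 h
    obtain ⟨N, hN⟩ := A.exists_forall_collapse_iterate_mem_core G hGD hyi
    have hclosed : IsClosed {v : M | ((β.symm (t, v)).1 i).2 ∈ E} :=
      B.isCompact.isClosed.preimage (continuous_snd.comp ((continuous_apply i).comp
        (continuous_subtype_val.comp (β.symm.continuous.comp (Continuous.prodMk_right t)))))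
    refine closure_minimal ?_ hclosed (mem_iInter₂.1 hw {j | N ≤ j} (mem_atTop N))
    rintro _ ⟨j, hj, x, rfl, rfl⟩
    change ((β.symm (t, (Φ t)^[j] x)).1 i).2 ∈ E
    rw [Homeomorph.fiber_iterate_apply, hΩiter, naturalExtension_iterate_apply]
    exact hcore.subset (hN j hj)
  · obtain ⟨k, hk, hFk⟩ := (hunwrap t).2
    exact ⟨k, hk, fun x hx => (hΦiter t k x hx).trans (hFk x hx)⟩
  · exact (hΦiter t k x hx).trans (hk x hx)
  · exact ContinuousMap.continuous_of_continuous_uncurry _ hcontg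
  · refine (ContinuousMap.dist_lt_iff hε).2 fun z => ?_
    have h := hβdist (β.symm (t, z))
    rw [β.apply_symm_apply, dist_comm] at h
    exact (le_max_right _ _).trans_lt h
  · change g t '' range (φ t) = _
    rw [← range_comp]
    ext y
    constructor
    · rintro ⟨x, rfl⟩
      exact ⟨x.1 0, x.apply_mem_range_iterate m 0, (hgφ t x).symm⟩
    · rintro ⟨e, he, rfl⟩
      obtain ⟨x, rfl⟩ := (hstab t).exists_inverseLimit_apply_zero he
      exact ⟨x, hgφ t x⟩
  · rintro _ ⟨x, rfl⟩
    refine ⟨x.1 0, (hgφ t x).symm, ?_⟩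
    rw [← hφconj, hgφ]
    rfl
  · have hper : {x | x ∈ Λ t ∧ x ∈ Function.periodicPts (Φ t)} =
        φ t '' Function.periodicPts (naturalExtension (f t)) := by
      have hiff (x : InverseLimit (f t)) (k : ℕ) : Function.IsPeriodicPt (Φ t) k (φ t x) ↔
          Function.IsPeriodicPt (naturalExtension (f t)) k x := by
        change (Φ t)^[k] (φ t x) = φ t x ↔ (naturalExtension (f t))^[k] x = x
        rw [← hφiter, (hφemb t).injective.eq_iff]
      ext z
      constructor
      · rintro ⟨⟨x, rfl⟩, k, hk, hx⟩
        exact ⟨x, ⟨k, hk, (hiff x k).1 hx⟩, rfl⟩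
      · rintro ⟨x, ⟨k, hk, hx⟩, rfl⟩
        exact ⟨⟨x, rfl⟩, k, hk, (hiff x k).2 hx⟩
    rw [hper, ← bijOn_comp_iff (hφemb t).injective.injOn]
    exact (Subtype.val_injective.injOn.bijOn_image.comp
      (bijOn_periodicPts_naturalExtension (f t))).congr fun x _ => (hgφ t x).symm
  · exact InverseLimit.continuous_of_coe_eq_range_fiberEmbedding hH hβfst hf hstab fun _ => rfl
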